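/- **Setting.** $K\ge 2$ messages $W_0,\dots,W_{K-1}$, independent and uniform over $\mathcal X^L$ ($\mathcal X$ finite and non-empty, $L\ge 1$), are replicated on $N$ servers $[0:N-1]$. A collusion pattern is a finite family $\mathcal P=\{\mathcal T_1,\dots,\mathcal T_M\}$ of subsets of $[0:N-1]$. A *PIR scheme* under $\mathcal P$ has a random key $F$, independent of the messages; queries $Q_n^{[k]}=\phi_n(k,F)$ with values in countable sets $\mathcal Q_n$; response lengths $\ell_n:\mathcal Q_n\to\mathbb Z_{\ge0}$; and responses $A_n^{[k]}=\varphi_n(Q_n^{[k]},W_{[0:K-1]})\in\mathcal Y^{\ell_n(Q_n^{[k]})}$ over a finite alphabet $\mathcal Y$. It satisfies, for all $k,k'$ and all $\mathcal T_m\in\mathcal P$, correctness, $H(W_k\mid A^{[k]}_{[0:N-1]},Q^{[k]}_{[0:N-1]})=0$, and privacy: $Q^{[k]}_{\mathcal T_m}$ and $Q^{[k']}_{\mathcal T_m}$ have the same distribution. Its rate is $R=\dfrac{L\log|\mathcal X|}{\log|\mathcal Y|\cdot\mathbb E\big(\sum_n \ell_n(Q^{[k]}_n)\big)}$ (all logarithms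 are to base $2$). The capacity is $$C_{\mathcal P}=\Big(1+\tfrac1{S^*}+\cdots+\big(\tfrac1{S^*}\big)^{K-1}\Big)^{-1},\qquad S^*=\max\Big\{\sum_n y_n:\ y\ge 0,\ \sum_{n\in\mathcal T_m}y_n\le 1\ \text{for all } m\Big\},$$ and a scheme achieves capacity if $R=C_{\mathcal P}$. The scheme is *uniformly decomposable* if $\mathcal Y$ is a finite abelian group and there are functions $\varphi^{(q)}_{n,i,k}:\mathcal X^L\to\mathcal Y$ such that the $i$-th symbol of $\varphi_n(q,W_{[0:K-1]})$ is $\varphi^{(q)}_{n,i,0}(W_0)+\cdots+\varphi^{(q)}_{n,i,K-1}(W_{K-1})$ for all $n$, all $q\in\mathcal Q_n$ and all $i\in[0:\ell_n(q)-1]$, and each $\varphi^{(q)}_{n,i,k}(W_k)$ is either uniformly distributed over $\mathcal Y$ or deterministic. Assume that the linear program $\min\sum_m x_m$ subject to $x\ge 0$ and $\sum_{m:\,n\in\mathcal T_m}x_m\ge 1$ for every server $n$ has an optimal solution with $x_m>0$ for all $m$ (in particular, every server lies in some $\mathcal T_m$). **Theorem.** For every uniformly decomposable PIR scheme under $\mathcal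 P$ that achieves capacity, the message size satisfies $$L\log|\mathcal X|\ \ge\ \alpha(\mathcal F(\mathcal P))\,\log|\mathcal Y|\ \ge\ \alpha(\mathcal F(\mathcal P)),$$ where $$\mathcal F(\mathcal P)=\big\{S\subseteq[0:N-1]:\ \exists\,\mathcal T_m\in\mathcal P,\ \mathcal T_m\subseteq S,\ \forall i\in\mathcal T_m\ \exists\,\mathcal T_r\in\mathcal P\text{ with }\mathcal T_r\subseteq S\setminus\{i\}\big\}$$ and $\alpha(\mathcal F(\mathcal P))$ is its hitting number, the minimum cardinality of a set of servers that intersects every member of $\mathcal F(\mathcal P)$. -/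

import Mathlib

open MeasureTheory

/-! Throughout, servers are indexed by `Fin N`, messages by `Fin K`, a message is an element of
`Fin L → X`, and a collusion pattern is a finite family `P` of sets of servers. -/

/-- The optimal value `S*` of the linear program
`max ∑ n, y n` subject to `∑ n ∈ T, y n ≤ 1` for all `T ∈ P`, and `y ≥ 0`. -/
noncomputable def packingValue {N : ℕ} (P : Finset (Finset (Fin N))) : ℝ :=
  sSup {s : ℝ | ∃ y : Fin N → ℝ,
    (∀ n, 0 ≤ y n) ∧ (∀ T ∈ P, ∑ n ∈ T, y n ≤ 1) ∧ s = ∑ n, y n}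

/-- The capacity `(1 + 1/S* + (1/S*)^2 + ⋯ + (1/S*)^(K-1))⁻¹` of private information retrieval
with `K` messages under the collusion pattern `P`. -/
noncomputable def pirCapacity {N : ℕ} (P : Finset (Finset (Fin N))) (K : ℕ) : ℝ :=
  (∑ j ∈ Finset.range K, (1 / packingValue P) ^ j)⁻¹

/-- `x` is feasible for the linear program
`min ∑ T ∈ P, x T` subject to `∑ T ∈ P with n ∈ T, x T ≥ 1` for every server `n`, and `x ≥ 0`.
Only the values of `x` on `P` matter. -/
def IsFractionalCover {N : ℕ} (P : Finset (Finset (Fin N))) (x : Finset (Fin N) → ℝ) : Prop :=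
  (∀ T ∈ P, 0 ≤ x T) ∧ ∀ n : Fin N, 1 ≤ ∑ T ∈ P with n ∈ T, x T

/-- `x` is an optimal solution of the linear program in `IsFractionalCover`. -/
def IsOptimalFractionalCover {N : ℕ} (P : Finset (Finset (Fin N)))
    (x : Finset (Fin N) → ℝ) : Prop :=
  IsFractionalCover P x ∧
    ∀ x' : Finset (Fin N) → ℝ, IsFractionalCover P x' → ∑ T ∈ P, x T ≤ ∑ T ∈ P, x' T

/-- The family `F(P)` of the sets `S` of servers that contain a colluding set `T ∈ P` such that,
for every `i ∈ T`, the set `S ∖ {i}` still contains some colluding set of `P`. -/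
def residualFamily {N : ℕ} (P : Finset (Finset (Fin N))) : Set (Finset (Fin N)) :=
  {S | ∃ T ∈ P, T ⊆ S ∧ ∀ i ∈ T, ∃ T' ∈ P, T' ⊆ S.erase i}

/-- The hitting number of a family of sets of servers: the minimum cardinality of a set
that intersects every member of the family. -/
noncomputable def hittingNumber {N : ℕ} (𝓕 : Set (Finset (Fin N))) : ℕ :=
  sInf {c : ℕ | ∃ H : Finset (Fin N), (∀ S ∈ 𝓕, (H ∩ S).Nonempty) ∧ H.card = c}

/-- A private information retrieval scheme under the collusion pattern `P`, with `K` messages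
in `Fin L → X`, coded-symbol alphabet `Y`, private keys in `Ω`, and queries to server `n` in the
countable set `Q n`. The messages are independent of the key and independent and uniform on
`Fin L → X`, so that every tuple of messages has positive probability. -/
structure PIRScheme {N : ℕ} (P : Finset (Finset (Fin N))) (K L : ℕ) (X Y : Type*)
    (Ω : Type*) [MeasurableSpace Ω] (Q : Fin N → Type*) where
  /-- the distribution of the private key -/
  keyLaw : Measure Ω
  isProbabilityMeasure_keyLaw : IsProbabilityMeasure keyLaw
  countable_query : ∀ n, Countable (Q n)
  /-- the query `Q_n^[k]` to server `n` for desired message `k`, a function of the key -/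
  query : ∀ n : Fin N, Fin K → Ω → Q n
  measurableSet_query : ∀ (n : Fin N) (k : Fin K) (q : Q n), MeasurableSet {f | query n k f = q}
  /-- the length of the response of server `n` to a query -/
  len : ∀ n : Fin N, Q n → ℕ
  /-- the response of server `n` to a query, given the stored messages -/
  response : ∀ (n : Fin N) (q : Q n), (Fin K → Fin L → X) → (Fin (len n q) → Y)
  /-- correctness: given any tuple of queries that occurs with positive probability, the desired
  message is a function of the responses, that is, `H(W_k | A, Q) = 0` -/
  correct : ∀ (k : Fin K) (q : ∀ n, Q n), 0 < keyLaw {f | ∀ n, query n k f = q n} →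
    ∃ decode : (∀ n, Fin (len n (q n)) → Y) → (Fin L → X),
      ∀ W : Fin K → Fin L → X, decode (fun n => response n (q n) W) = W k
  /-- privacy: the joint law of the queries to a colluding set does not depend on the desired
  message -/
  privacy : ∀ T ∈ P, ∀ (k k' : Fin K) (q : ∀ n, Q n),
    keyLaw {f | ∀ n ∈ T, query n k f = q n} = keyLaw {f | ∀ n ∈ T, query n k' f = q n}

namespace PIRScheme

variable {N : ℕ} {P : Finset (Finset (Fin N))} {K L : ℕ} {X Y : Type*}
  {Ω : Type*} [MeasurableSpace Ω] {Q : Fin N → Type*}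

/-- The expected total number of downloaded symbols when message `k` is desired. -/
noncomputable def expectedDownload (σ : PIRScheme P K L X Y Ω Q) (k : Fin K) : ℝ :=
  ∫ f, ((∑ n, σ.len n (σ.query n k f) : ℕ) : ℝ) ∂σ.keyLaw

/-- The rate `L log|X| / (log|Y| ⬝ E[∑ n, ℓ_n])`, when message `k` is desired. If every server lies
in a colluding set, then privacy makes it independent of `k`. If the expected download is infinite,
then `expectedDownload` is zero and the rate is zero as well, as it should be. -/
noncomputable def rate [Fintype X] [Fintype Y] (σ : PIRScheme P K L X Y Ω Q) (k : Fin K) : ℝ :=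
  (L * Real.logb 2 (Fintype.card X)) / (Real.logb 2 (Fintype.card Y) * σ.expectedDownload k)

/-- The scheme achieves the capacity. -/
def AchievesCapacity [Fintype X] [Fintype Y] (σ : PIRScheme P K L X Y Ω Q) : Prop :=
  ∀ k : Fin K, σ.rate k = pirCapacity P K

/-- The functions `φ n q i k`, from messages to `Y`, decompose the responses of the scheme:
the `i`-th symbol of the response of server `n` to the query `q` is `∑ k, φ n q i k (W k)`. -/
def IsDecomposition [AddCommGroup Y] (σ : PIRScheme P K L X Y Ω Q)
    (φ : ∀ (n : Fin N) (q : Q n), Fin (σ.len n q) → Fin K → (Fin L → X) → Y) : Prop :=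
  ∀ (n : Fin N) (q : Q n) (W : Fin K → Fin L → X) (i : Fin (σ.len n q)),
    σ.response n q W i = ∑ k, φ n q i k (W k)

/-- The scheme is decomposable over the finite abelian group `Y`, and each component function of a
uniform message is either uniformly distributed over `Y` or deterministic. -/
def IsUniformlyDecomposable [Fintype X] [Nonempty X] [Fintype Y] [AddCommGroup Y]
    (σ : PIRScheme P K L X Y Ω Q) : Prop :=
  ∃ φ : ∀ (n : Fin N) (q : Q n), Fin (σ.len n q) → Fin K → (Fin L → X) → Y,
    σ.IsDecomposition φ ∧
      ∀ (n : Fin N) (q : Q n) (i : Fin (σ.len n q)) (k : Fin K),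
        (PMF.uniformOfFintype (Fin L → X)).map (φ n q i k) = PMF.uniformOfFintype Y ∨
          ∃ c : Y, ∀ w : Fin L → X, φ n q i k w = c

end PIRScheme

/-! The theorem comes from the equality case of the converse bound. Write Λ = L log|X|, let ξ be the
value of the given optimal cover x, and let H_m(B) be the entropy of the responses of the servers in
B given the queries and the messages with index below m. Correctness splits Λ off: H_m(all) = Λ +
H_{m+1}(all) when message m is desired. Since H_m is submodular, Shearer's inequality bounds
H_m(all) by ∑ x_T H_m(T). By privacy each H_m(T) has the same mean for every desired message, and
H_m(T) ≤ H_m(all). Induction over the messages (`le_meanEntropy`) gives Λ(1 + 1/ξ + ⋯ + ξ^{-(K-1)})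
≤ E[ℓ] log|Y|, where ℓ is the total response length. Strong duality gives ξ ≤ S*, so at capacity
every inequality is tight. As all x_T are positive, some query tuple satisfies Λ + H_1(all) = ℓ
log|Y| and H_1(T) = H_1(all) > 0 for every T ∈ P (`exists_tight_query`). For these queries every
colluding set contains a server with a nonempty response. Deleting such servers while a colluding
set survives removes at least α of them (`exists_subset_hittingNumber_le`). A surviving T has H_1(T)
≤ ℓ(T) log|Y|, hence Λ ≥ (ℓ - ℓ(T)) log|Y| ≥ α log|Y|. -/

/-! ### Entropy of an equivalence relation under the uniform distribution -/

namespace Setoid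

variable {α : Type*} [Fintype α]

open Classical in
/-- The number of elements in the class of `a`. -/
noncomputable def classCard (r : Setoid α) (a : α) : ℕ :=
  (Finset.univ.filter fun b => r a b).card

/-- The Shannon entropy (in nats) of the class of a uniformly distributed element. If `r` is the
kernel of a function `f`, then this is the entropy of `f`; the entropy of a pair of functions is
that of the infimum of their kernels. -/
noncomputable def entropy (r : Setoid α) : ℝ :=
  (∑ a, Real.log (Fintype.card α / r.classCard a)) / Fintype.card α

lemma classCard_pos (r : Setoid α) (a : α) : 0 < r.classCard a :=
  Finset.card_pos.2 ⟨a, by simp⟩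

lemma classCard_congr (r : Setoid α) {a b : α} (h : r a b) : r.classCard a = r.classCard b := by
  classical
  unfold classCard
  congr 1
  ext c
  simp only [Finset.mem_filter, Finset.mem_univ, true_and]
  exact ⟨fun hc => r.trans (r.symm h) hc, fun hc => r.trans h hc⟩

lemma classCard_mono {r s : Setoid α} (h : r ≤ s) (a : α) : r.classCard a ≤ s.classCard a := by
  classical
  exact Finset.card_le_card (Finset.monotone_filter_right _ fun b _ hb => h hb)

lemma entropy_anti {r s : Setoid α} (h : r ≤ s) : s.entropy ≤ r.entropy := by
  unfold entropy
  gcongr with a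
  · have := s.classCard_pos a
    have : 0 < Fintype.card α := Fintype.card_pos_iff.2 ⟨a⟩
    positivity
  · exact_mod_cast r.classCard_pos a
  · exact classCard_mono h a

lemma entropy_top : (⊤ : Setoid α).entropy = 0 := by
  classical
  unfold entropy
  rw [Finset.sum_eq_zero, zero_div]
  intro a _
  have h : (⊤ : Setoid α).classCard a = Fintype.card α := by
    unfold classCard
    rw [← Finset.card_univ]
    congr 1
    ext b
    simp
  have : (Fintype.card α : ℝ) ≠ 0 := by
    exact_mod_cast (Fintype.card_pos_iff.2 ⟨a⟩).ne'
  rw [h, div_self this, Real.log_one]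

lemma entropy_nonneg (r : Setoid α) : 0 ≤ r.entropy :=
  entropy_top.symm.le.trans (entropy_anti le_top)

/-- The reciprocals of the class sizes add up to at most one over a part of one class. -/
lemma sum_inv_classCard_le_one (r : Setoid α) (s : Finset α)
    (hs : ∀ a ∈ s, ∀ b ∈ s, r a b) : ∑ a ∈ s, (r.classCard a : ℝ)⁻¹ ≤ 1 := by
  classical
  rcases s.eq_empty_or_nonempty with rfl | ⟨c, hc⟩
  · simp
  rw [Finset.sum_congr rfl fun a ha => by rw [r.classCard_congr (hs a ha c hc)]]
  rw [Finset.sum_const, nsmul_eq_mul]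
  have h1 : (0 : ℝ) < r.classCard c := by exact_mod_cast r.classCard_pos c
  have h2 : s.card ≤ r.classCard c :=
    Finset.card_le_card fun a ha => by simpa using hs c hc a ha
  rw [mul_inv_le_iff₀ h1, one_mul]
  exact_mod_cast h2

/-- Apply log u ≤ u - 1 to u = |α| / (|β| · class size). The reciprocals of the class sizes sum to
at most one over each fibre, hence to at most |β|. -/
lemma entropy_ker_le {β : Type*} [Fintype β] (f : α → β) :
    (ker f).entropy ≤ Real.log (Fintype.card β) := by
  classical
  rcases isEmpty_or_nonempty α with hα | ⟨⟨a₀⟩⟩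
  · simpa [entropy] using Real.log_natCast_nonneg _
  have hα : (0 : ℝ) < Fintype.card α := by exact_mod_cast Fintype.card_pos_iff.2 ⟨a₀⟩
  have hβ : (0 : ℝ) < Fintype.card β := by exact_mod_cast Fintype.card_pos_iff.2 ⟨f a₀⟩
  have hc : ∀ a, (0 : ℝ) < (ker f).classCard a := fun a => by
    exact_mod_cast (ker f).classCard_pos a
  have hsum : ∑ a, ((ker f).classCard a : ℝ)⁻¹ ≤ Fintype.card β := by
    rw [← Finset.sum_fiberwise Finset.univ f]
    refine (Finset.sum_le_sum (g := fun _ => 1) fun b _ =>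
      sum_inv_classCard_le_one _ _ fun a ha a' ha' => ?_).trans (by simp)
    simp only [Finset.mem_filter, Finset.mem_univ, true_and] at ha ha'
    simp [ker_def, ha, ha']
  unfold entropy
  rw [div_le_iff₀ hα]
  calc ∑ a, Real.log (Fintype.card α / (ker f).classCard a)
      ≤ ∑ a, (Real.log (Fintype.card β) +
          (Fintype.card α / Fintype.card β * ((ker f).classCard a : ℝ)⁻¹ - 1)) := by
        refine Finset.sum_le_sum fun a _ => ?_
        have h := Real.log_le_sub_one_of_pos
          (x := Fintype.card α / Fintype.card β * ((ker f).classCard a : ℝ)⁻¹)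
          (mul_pos (div_pos hα hβ) (inv_pos.2 (hc a)))
        rw [Real.log_mul (div_pos hα hβ).ne' (inv_pos.2 (hc a)).ne', Real.log_div hα.ne' hβ.ne',
          Real.log_inv] at h
        rw [Real.log_div hα.ne' (hc a).ne']
        linarith
    _ = Real.log (Fintype.card β) * Fintype.card α +
          (Fintype.card α / Fintype.card β * ∑ a, ((ker f).classCard a : ℝ)⁻¹ -
            Fintype.card α) := by
        rw [Finset.sum_add_distrib, Finset.sum_sub_distrib, ← Finset.mul_sum]
        simp [mul_comm]
    _ ≤ Real.log (Fintype.card β) * Fintype.card α +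
          (Fintype.card α / Fintype.card β * Fintype.card β - Fintype.card α) := by
        gcongr
    _ = _ := by rw [div_mul_cancel₀ _ hβ.ne']; ring

/-- Submodularity of entropy: conditional mutual information is nonnegative. -/
lemma entropy_submodular (r s t : Setoid α) :
    (r ⊓ s ⊓ t).entropy + t.entropy ≤ (r ⊓ t).entropy + (s ⊓ t).entropy := by
  classical
  have hc : ∀ (u : Setoid α) a, (0 : ℝ) < u.classCard a := fun u a => by
    exact_mod_cast u.classCard_pos a
  -- Double counting of triples (a, b, c). For fixed b and c, the admissible a lie in one class of
  -- `r ⊓ s ⊓ t`, so they contribute at most the reciprocal of the `t`-class size of b. Summing over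
  -- c in that class gives 1. The lemma then follows from log u ≤ u - 1.
  have key : ∑ a, ((r ⊓ t).classCard a : ℝ) * (s ⊓ t).classCard a *
      (((r ⊓ s ⊓ t).classCard a : ℝ)⁻¹ * (t.classCard a : ℝ)⁻¹) ≤ Fintype.card α := by
    have e : ∀ (u : Setoid α) a, (u.classCard a : ℝ) = ∑ b, if u a b then 1 else 0 := by
      intro u a
      simp [classCard]
    calc _ = ∑ a, ∑ b, ∑ c, (if (r ⊓ t) a b ∧ (s ⊓ t) a c then
            ((r ⊓ s ⊓ t).classCard a : ℝ)⁻¹ * (t.classCard a : ℝ)⁻¹ else 0) := by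
          refine Finset.sum_congr rfl fun a _ => ?_
          rw [e (r ⊓ t) a, e (s ⊓ t) a, Finset.sum_mul_sum, Finset.sum_mul]
          refine Finset.sum_congr rfl fun b _ => ?_
          rw [Finset.sum_mul]
          refine Finset.sum_congr rfl fun c _ => ?_
          by_cases h1 : (r ⊓ t) a b <;> by_cases h2 : (s ⊓ t) a c <;> simp [h1, h2]
      _ = ∑ b, ∑ c, ∑ a, (if (r ⊓ t) a b ∧ (s ⊓ t) a c then
            ((r ⊓ s ⊓ t).classCard a : ℝ)⁻¹ * (t.classCard a : ℝ)⁻¹ else 0) := by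
          rw [Finset.sum_comm]
          exact Finset.sum_congr rfl fun b _ => Finset.sum_comm
      _ ≤ ∑ b, ∑ c, (if t b c then (t.classCard b : ℝ)⁻¹ else 0) := by
          refine Finset.sum_le_sum fun b _ => Finset.sum_le_sum fun c _ => ?_
          rw [← Finset.sum_filter]
          by_cases hbc : t b c
          · rw [if_pos hbc]
            calc _ = ∑ a ∈ Finset.univ.filter (fun a => (r ⊓ t) a b ∧ (s ⊓ t) a c),
                    ((r ⊓ s ⊓ t).classCard a : ℝ)⁻¹ * (t.classCard b : ℝ)⁻¹ := by
                  refine Finset.sum_congr rfl fun a ha => ?_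
                  rw [t.classCard_congr (Finset.mem_filter.1 ha).2.1.2]
              _ ≤ 1 * (t.classCard b : ℝ)⁻¹ := by
                  rw [← Finset.sum_mul]
                  refine mul_le_mul_of_nonneg_right
                    (sum_inv_classCard_le_one _ _ fun a ha a' ha' => ?_) (inv_pos.2 (hc t b)).le
                  simp only [Finset.mem_filter, Finset.mem_univ, true_and] at ha ha'
                  exact ⟨⟨r.trans ha.1.1 (r.symm ha'.1.1), s.trans ha.2.1 (s.symm ha'.2.1)⟩,
                    t.trans ha.1.2 (t.symm ha'.1.2)⟩
              _ = _ := one_mul _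
          · rw [if_neg hbc, Finset.filter_false_of_mem, Finset.sum_empty]
            rintro a - ⟨h1, h2⟩
            exact hbc (t.trans (t.symm h1.2) h2.2)
      _ = ∑ b : α, 1 := by
          refine Finset.sum_congr rfl fun b _ => ?_
          rw [← Finset.sum_filter, Finset.sum_const, nsmul_eq_mul]
          exact mul_inv_cancel₀ (hc t b).ne'
      _ = _ := by simp
  unfold entropy
  rw [← add_div, ← add_div, ← Finset.sum_add_distrib, ← Finset.sum_add_distrib]
  refine div_le_div_of_nonneg_right ?_ (Nat.cast_nonneg _)
  rw [← sub_nonpos, ← Finset.sum_sub_distrib]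
  refine (Finset.sum_le_sum (g := fun a => ((r ⊓ t).classCard a : ℝ) * (s ⊓ t).classCard a *
      (((r ⊓ s ⊓ t).classCard a : ℝ)⁻¹ * (t.classCard a : ℝ)⁻¹) - 1) fun a _ => ?_).trans ?_
  · have hα : (Fintype.card α : ℝ) ≠ 0 := by
      exact_mod_cast (Fintype.card_pos_iff.2 ⟨a⟩).ne'
    have h1 := hc (r ⊓ t) a
    have h2 := hc (s ⊓ t) a
    have h3 := hc (r ⊓ s ⊓ t) a
    have h4 := hc t a
    refine le_trans (le_of_eq ?_) (Real.log_le_sub_one_of_pos (by positivity))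
    rw [Real.log_mul (by positivity) (by positivity), Real.log_mul h1.ne' h2.ne',
      Real.log_mul (by positivity) (by positivity), Real.log_inv, Real.log_inv,
      Real.log_div hα h1.ne', Real.log_div hα h2.ne', Real.log_div hα h3.ne',
      Real.log_div hα h4.ne']
    ring
  · rw [Finset.sum_sub_distrib]
    simpa using key

end Setoid

/-! ### Fractional covers -/

/-- A submodular function with value zero at `∅` has, for each set `S`, an additive minorant on the
subsets of `S` that agrees with it at `S`. -/
lemma exists_additive_minorant {ι : Type*} [DecidableEq ι] (h : Finset ι → ℝ) (h0 : h ∅ = 0)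
    (hmono : Monotone h) (hsub : ∀ A B, h (A ∪ B) + h (A ∩ B) ≤ h A + h B) (S : Finset ι) :
    ∃ w : ι → ℝ, (∀ i, 0 ≤ w i) ∧ ∑ i ∈ S, w i = h S ∧ ∀ T ⊆ S, ∑ i ∈ T, w i ≤ h T := by
  induction S using Finset.induction_on with
  | empty =>
    refine ⟨0, fun _ => le_rfl, by simp [h0], fun T hT => ?_⟩
    rw [Finset.subset_empty.1 hT]
    simp [h0]
  | insert n S hn ih =>
    obtain ⟨w, hw0, hwS, hwT⟩ := ih
    have hne : ∀ T ⊆ S, ∀ v : ℝ, ∑ i ∈ T, Function.update w n v i = ∑ i ∈ T, w i := by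
      intro T hT v
      refine Finset.sum_congr rfl fun i hi => Function.update_of_ne ?_ _ _
      rintro rfl
      exact hn (hT hi)
    -- Greedy choice: the new weight is the marginal gain of `n`. If `T` contains `n`, submodularity
    -- for `T` and `S` says that the gain over `T.erase n` is at least as large.
    refine ⟨Function.update w n (h (insert n S) - h S), fun i => ?_, ?_, fun T hT => ?_⟩
    · by_cases hi : i = n
      · subst hi
        simpa using hmono (Finset.subset_insert i S)
      · simpa [hi] using hw0 i
    · rw [Finset.sum_insert hn, hne S subset_rfl, hwS]
      simp
    · by_cases hnT : n ∈ T
      · have hTS : T.erase n ⊆ S := Finset.subset_insert_iff.1 hT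
        rw [← Finset.add_sum_erase T _ hnT, hne _ hTS]
        have h1 := hwT _ hTS
        have h2 := hsub T S
        have e1 : T ∪ S = insert n S := by
          ext i
          simp only [Finset.mem_union, Finset.mem_insert]
          refine ⟨fun hi => ?_, fun hi => ?_⟩
          · rcases hi with hi | hi
            · exact Finset.mem_insert.1 (hT hi)
            · exact Or.inr hi
          · rcases hi with rfl | hi
            · exact Or.inl hnT
            · exact Or.inr hi
        have e2 : T ∩ S = T.erase n := by
          ext i
          simp only [Finset.mem_inter, Finset.mem_erase]
          refine ⟨fun hi => ⟨?_, hi.1⟩, fun hi => ⟨hi.2, hTS (Finset.mem_erase.2 hi)⟩⟩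
          rintro rfl
          exact hn hi.2
        rw [e1, e2] at h2
        simp only [Function.update_self]
        linarith
      · have hTS : T ⊆ S := (Finset.subset_insert_iff_of_notMem hnT).1 hT
        rw [hne T hTS]
        exact hwT T hTS

/-- Shearer's inequality for fractional covers. -/
lemma IsFractionalCover.le_sum_mul {N : ℕ} {P : Finset (Finset (Fin N))}
    {x : Finset (Fin N) → ℝ} (hx : IsFractionalCover P x) (h : Finset (Fin N) → ℝ) (h0 : h ∅ = 0)
    (hmono : Monotone h) (hsub : ∀ A B, h (A ∪ B) + h (A ∩ B) ≤ h A + h B) :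
    h Finset.univ ≤ ∑ T ∈ P, x T * h T := by
  obtain ⟨w, hw0, hwS, hwT⟩ := exists_additive_minorant h h0 hmono hsub Finset.univ
  calc h Finset.univ = ∑ n, w n * 1 := by simp [hwS]
    _ ≤ ∑ n, w n * ∑ T ∈ P with n ∈ T, x T :=
        Finset.sum_le_sum fun n _ => mul_le_mul_of_nonneg_left (hx.2 n) (hw0 n)
    _ = ∑ T ∈ P, x T * ∑ n ∈ T, w n := by
        simp only [Finset.mul_sum, Finset.sum_filter]
        rw [Finset.sum_comm]
        refine Finset.sum_congr rfl fun T _ => ?_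
        rw [← Finset.sum_subset (Finset.subset_univ T)]
        · exact Finset.sum_congr rfl fun n hn => by simp [hn, mul_comm]
        · intro n _ hn
          simp [hn]
    _ ≤ _ := Finset.sum_le_sum fun T hT =>
        mul_le_mul_of_nonneg_left (hwT T (Finset.subset_univ T)) (hx.1 T hT)

/-- Weak duality: the values of the packing program are bounded by those of the covering
program. -/
lemma IsFractionalCover.sum_packing_le {N : ℕ} {P : Finset (Finset (Fin N))}
    {x : Finset (Fin N) → ℝ} (hx : IsFractionalCover P x) {y : Fin N → ℝ} (hy0 : ∀ n, 0 ≤ y n)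
    (hy : ∀ T ∈ P, ∑ n ∈ T, y n ≤ 1) : ∑ n, y n ≤ ∑ T ∈ P, x T := by
  refine (hx.le_sum_mul (fun S => ∑ n ∈ S, y n) (by simp) (fun A B hAB => ?_)
    (fun A B => (Finset.sum_union_inter).le)).trans (Finset.sum_le_sum fun T hT => ?_)
  · exact Finset.sum_le_sum_of_subset_of_nonneg hAB fun n _ _ => hy0 n
  · simpa using mul_le_mul_of_nonneg_left (hy T hT) (hx.1 T hT)

/-- Strong duality: the packing value is at least the optimal value of the covering program. -/
lemma IsOptimalFractionalCover.sum_le_packingValue {N : ℕ} {P : Finset (Finset (Fin N))}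
    {x : Finset (Fin N) → ℝ} (hx : IsOptimalFractionalCover P x) :
    ∑ T ∈ P, x T ≤ packingValue P := by
  classical
  have hbdd : BddAbove {s : ℝ | ∃ y : Fin N → ℝ,
      (∀ n, 0 ≤ y n) ∧ (∀ T ∈ P, ∑ n ∈ T, y n ≤ 1) ∧ s = ∑ n, y n} := by
    refine ⟨∑ T ∈ P, x T, ?_⟩
    rintro s ⟨y, hy0, hy, rfl⟩
    exact hx.1.sum_packing_le hy0 hy
  have hS0 : 0 ≤ packingValue P :=
    le_csSup hbdd ⟨0, fun _ => le_rfl, fun T _ => by simp, by simp⟩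
  -- For v > S*, no probability vector loads every colluding set by at most 1/v, since scaling it by
  -- v would give a packing of value v. A hyperplane separating the loads from this orthant yields a
  -- cover of value v.
  refine le_of_forall_gt_imp_ge_of_dense fun v hv => ?_
  have hv0 : 0 < v := hS0.trans_lt hv
  let load : (Fin N → ℝ) →ₗ[ℝ] (P → ℝ) :=
    LinearMap.pi fun T => ∑ n ∈ T.1, LinearMap.proj n
  have hload : ∀ y T, load y T = ∑ n ∈ T.1, y n := fun y T => by
    simp [load, LinearMap.sum_apply]
  have hconv : Convex ℝ (load '' stdSimplex ℝ (Fin N)) :=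
    (convex_stdSimplex ℝ (Fin N)).is_linear_image load.isLinear
  have hcomp : IsCompact (load '' stdSimplex ℝ (Fin N)) :=
    (isCompact_stdSimplex ℝ (Fin N)).image load.continuous_of_finiteDimensional
  have hdisj : Disjoint (load '' stdSimplex ℝ (Fin N)) (Set.Iic fun _ => v⁻¹) := by
    rw [Set.disjoint_left]
    rintro _ ⟨y, hy, rfl⟩ hle
    refine absurd (le_csSup hbdd ⟨v • y, fun n => mul_nonneg hv0.le (hy.1 n), fun T hT => ?_,
      rfl⟩) (not_le.2 ?_)
    · have h := hle ⟨T, hT⟩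
      rw [hload] at h
      simp only [Pi.smul_apply, smul_eq_mul, ← Finset.mul_sum]
      calc _ ≤ v * v⁻¹ := mul_le_mul_of_nonneg_left h hv0.le
        _ = 1 := mul_inv_cancel₀ hv0.ne'
    · simp only [Pi.smul_apply, smul_eq_mul, ← Finset.mul_sum, hy.2, mul_one]
      exact hv
  obtain ⟨g, a, b, hga, hab, hgb⟩ :=
    geometric_hahn_banach_compact_closed hconv hcomp (convex_Iic _) isClosed_Iic hdisj
  set c : P → ℝ := fun T => - g (Pi.single T 1) with hc
  have hg : ∀ z, g z = - ∑ T, z T * c T := by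
    intro z
    conv_lhs => rw [← Finset.univ_sum_single z]
    rw [map_sum, ← Finset.sum_neg_distrib]
    refine Finset.sum_congr rfl fun T _ => ?_
    have : (Pi.single T (z T) : P → ℝ) = z T • Pi.single T 1 := by
      rw [← Pi.single_smul]; simp
    rw [this, map_smul, hc]
    simp
  have hc0 : ∀ T, 0 ≤ c T := by
    intro T
    by_contra hneg
    push Not at hneg
    -- The orthant is unbounded in the direction of minus the basis vector of `T`. A negative `c T`
    -- would push `g` below `b` far enough along it.
    obtain ⟨m, hm⟩ := exists_nat_gt ((-b - ∑ S, v⁻¹ * c S) / (-c T))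
    rw [div_lt_iff₀ (by linarith)] at hm
    have h := hgb ((fun _ => v⁻¹) - (m : ℝ) • Pi.single T 1) (by
      intro S
      simp only [Pi.sub_apply, Pi.smul_apply, smul_eq_mul, sub_le_self_iff]
      by_cases hS : S = T
      · subst hS; simp
      · simp [hS])
    rw [map_sub, map_smul, hg (fun _ => v⁻¹)] at h
    have h2 : g (Pi.single T 1) = - c T := by simp [hc]
    rw [h2, smul_eq_mul] at h
    nlinarith
  have hb : b < - ∑ S, v⁻¹ * c S := by
    rw [← hg fun _ => v⁻¹]
    exact hgb _ (Set.mem_Iic.2 le_rfl)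
  -- Evaluate the separation at the vertices of the simplex.
  have hcov : ∀ n, v⁻¹ * ∑ S, c S < ∑ S : P, if n ∈ S.1 then c S else 0 := by
    intro n
    have h := hga _ ⟨_, single_mem_stdSimplex ℝ n, rfl⟩
    rw [hg] at h
    simp only [hload] at h
    rw [← Finset.mul_sum] at hb
    refine lt_of_lt_of_eq (by linarith : _ < ∑ S : P, (∑ m ∈ S.1, Pi.single n 1 m) * c S)
      (Finset.sum_congr rfl fun S _ => ?_)
    simp [Pi.single_apply]
  rcases N.eq_zero_or_pos with rfl | hN
  · refine (hx.2 0 ⟨fun _ _ => le_rfl, fun n => n.elim0⟩).trans ?_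
    simpa using hv0.le
  have hpos : 0 < ∑ S, c S := by
    refine lt_of_le_of_ne (Finset.sum_nonneg fun S _ => hc0 S) fun h => ?_
    have h1 := hcov ⟨0, hN⟩
    rw [← h, mul_zero] at h1
    refine h1.not_ge ((Finset.sum_le_sum fun S _ => ?_).trans h.symm.le)
    split_ifs
    · exact le_rfl
    · exact hc0 S
  let x' : Finset (Fin N) → ℝ := fun T => if h : T ∈ P then v / (∑ S, c S) * c ⟨T, h⟩ else 0
  have hx' : ∀ S : P, x' S = v / (∑ S, c S) * c S := fun S => by simp [x']
  refine (hx.2 x' ⟨fun T hT => ?_, fun n => ?_⟩).trans ?_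
  · rw [hx' ⟨T, hT⟩]
    exact mul_nonneg (div_pos hv0 hpos).le (hc0 _)
  · rw [Finset.sum_filter, ← Finset.sum_coe_sort P]
    have h := mul_lt_mul_of_pos_left (hcov n) (div_pos hv0 hpos)
    rw [Finset.mul_sum _ _ (v / _)] at h
    have e : v / (∑ S, c S) * (v⁻¹ * ∑ S, c S) = 1 := by field_simp
    rw [e] at h
    refine h.le.trans (le_of_eq (Finset.sum_congr rfl fun S _ => ?_))
    rw [hx']
    split_ifs <;> simp
  · rw [← Finset.sum_coe_sort P, Finset.sum_congr rfl fun S _ => hx' S, ← Finset.mul_sum,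
      div_mul_cancel₀ _ hpos.ne']

/-! ### Sets of servers that survive deletions -/

lemma hittingNumber_le {N : ℕ} {𝓕 : Set (Finset (Fin N))} (H : Finset (Fin N))
    (hH : ∀ S ∈ 𝓕, (H ∩ S).Nonempty) : hittingNumber 𝓕 ≤ H.card :=
  Nat.sInf_le ⟨H, hH, rfl⟩

lemma residualFamily_mono {N : ℕ} {P : Finset (Finset (Fin N))} {S S' : Finset (Fin N)}
    (h : S ⊆ S') (hS : S ∈ residualFamily P) : S' ∈ residualFamily P := by
  obtain ⟨T, hT, hTS, hi⟩ := hS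
  refine ⟨T, hT, hTS.trans h, fun i hiT => ?_⟩
  obtain ⟨T', hT', hT'S⟩ := hi i hiT
  exact ⟨T', hT', hT'S.trans (Finset.erase_subset_erase i h)⟩

/-- If every colluding set contains a server with a nonempty response, then one can delete
`hittingNumber (residualFamily P)` servers with nonempty responses and keep a colluding set. -/
lemma exists_subset_hittingNumber_le {N : ℕ} {P : Finset (Finset (Fin N))} (hP : P.Nonempty)
    (l : Fin N → ℕ) (hl : ∀ T ∈ P, ∃ n ∈ T, 1 ≤ l n) :
    ∃ T ∈ P, hittingNumber (residualFamily P) + ∑ n ∈ T, l n ≤ ∑ n, l n := by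
  classical
  -- The sets left after deleting only servers with nonempty responses, as long as some colluding
  -- set survives. A minimal one admits no further deletion, so it is outside the residual family.
  let good : Finset (Finset (Fin N)) :=
    Finset.univ.filter fun V => (∃ T ∈ P, T ⊆ V) ∧ ∀ n ∉ V, 1 ≤ l n
  have hgood : good.Nonempty := by
    obtain ⟨T, hT⟩ := hP
    exact ⟨Finset.univ, by simpa [good] using ⟨T, hT⟩⟩
  obtain ⟨V, hV, hmin⟩ := good.exists_min_image Finset.card hgood
  obtain ⟨⟨T, hT, hTV⟩, hVl⟩ := (Finset.mem_filter.1 hV).2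
  have hVF : V ∉ residualFamily P := by
    rintro ⟨T₁, hT₁, hT₁V, hi⟩
    obtain ⟨n, hn, hln⟩ := hl T₁ hT₁
    refine (Finset.card_erase_lt_of_mem (hT₁V hn)).not_ge (hmin _ ?_)
    refine Finset.mem_filter.2 ⟨Finset.mem_univ _, hi n hn, fun m hm => ?_⟩
    by_cases hmn : m = n
    · exact hmn ▸ hln
    · exact hVl m fun hmV => hm (Finset.mem_erase.2 ⟨hmn, hmV⟩)
  refine ⟨T, hT, ?_⟩
  -- A member of the residual family missed by `Vᶜ` would lie inside `V`, and the family is closed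
  -- under supersets.
  have h1 : hittingNumber (residualFamily P) ≤ Vᶜ.card := by
    refine hittingNumber_le _ fun S hS => ?_
    by_contra hne
    rw [Finset.not_nonempty_iff_eq_empty, ← Finset.disjoint_iff_inter_eq_empty] at hne
    refine hVF (residualFamily_mono (fun n hn => ?_) hS)
    by_contra hnV
    exact Finset.disjoint_left.1 hne (Finset.mem_compl.2 hnV) hn
  have h2 : Vᶜ.card ≤ ∑ n ∈ Vᶜ, l n := by
    rw [Finset.card_eq_sum_ones]
    exact Finset.sum_le_sum fun n hn => hVl n (Finset.mem_compl.1 hn)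
  have h3 : ∑ n ∈ T, l n ≤ ∑ n ∈ V, l n := Finset.sum_le_sum_of_subset hTV
  have h4 := Finset.sum_add_sum_compl V l
  omega

namespace PIRScheme

variable {N : ℕ} {P : Finset (Finset (Fin N))} {K L : ℕ} {X Y : Type*}
  {Ω : Type*} [MeasurableSpace Ω] {Q : Fin N → Type*}

/-! ### Entropy of the responses given the first messages -/

/-- Two tuples of messages are equivalent if they agree on the messages with index below `m`. -/
def firstMessages (K L : ℕ) (X : Type*) (m : ℕ) : Setoid (Fin K → Fin L → X) where
  r a b := ∀ j : Fin K, (j : ℕ) < m → a j = b j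
  iseqv := ⟨fun _ _ _ => rfl, fun h j hj => (h j hj).symm,
    fun h h' j hj => (h j hj).trans (h' j hj)⟩

/-- Two tuples of messages are equivalent if the servers in `B` respond in the same way to the
queries `q`. -/
def responses (σ : PIRScheme P K L X Y Ω Q) (q : ∀ n, Q n) (B : Finset (Fin N)) :
    Setoid (Fin K → Fin L → X) where
  r a b := ∀ n ∈ B, σ.response n (q n) a = σ.response n (q n) b
  iseqv := ⟨fun _ _ _ => rfl, fun h n hn => (h n hn).symm,
    fun h h' n hn => (h n hn).trans (h' n hn)⟩

/-- The conditional entropy, given the messages with index below `m`, of the responses of the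
servers in `B` to the queries `q`. -/
noncomputable def condEntropy [Fintype X] (σ : PIRScheme P K L X Y Ω Q) (m : ℕ)
    (B : Finset (Fin N)) (q : ∀ n, Q n) : ℝ :=
  (σ.responses q B ⊓ firstMessages K L X m).entropy - (firstMessages K L X m).entropy

section Entropy

variable [Fintype X] (σ : PIRScheme P K L X Y Ω Q)

lemma condEntropy_nonneg (m : ℕ) (B : Finset (Fin N)) (q : ∀ n, Q n) :
    0 ≤ σ.condEntropy m B q :=
  sub_nonneg.2 (Setoid.entropy_anti inf_le_right)

lemma condEntropy_empty (m : ℕ) (q : ∀ n, Q n) : σ.condEntropy m ∅ q = 0 := by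
  have h : σ.responses q ∅ = ⊤ := by
    ext a b
    exact ⟨fun _ => trivial, fun _ n hn => absurd hn (Finset.notMem_empty n)⟩
  simp [condEntropy, h]

lemma condEntropy_mono (m : ℕ) (q : ∀ n, Q n) : Monotone fun B => σ.condEntropy m B q := by
  intro B B' h
  have hle : σ.responses q B' ≤ σ.responses q B := fun _ _ hab n hn => hab n (h hn)
  exact sub_le_sub_right (Setoid.entropy_anti (inf_le_inf_right _ hle)) _

/-- This is nonnegativity of the mutual information of the responses of `A` and `B`, conditioned on
the first messages and the responses of `A ∩ B`. -/
lemma condEntropy_submodular (m : ℕ) (q : ∀ n, Q n) (A B : Finset (Fin N)) :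
    σ.condEntropy m (A ∪ B) q + σ.condEntropy m (A ∩ B) q ≤
      σ.condEntropy m A q + σ.condEntropy m B q := by
  have h := Setoid.entropy_submodular (σ.responses q A) (σ.responses q B)
    (σ.responses q (A ∩ B) ⊓ firstMessages K L X m)
  have e1 : σ.responses q A ⊓ σ.responses q B ⊓
      (σ.responses q (A ∩ B) ⊓ firstMessages K L X m) =
      σ.responses q (A ∪ B) ⊓ firstMessages K L X m := by
    ext a b
    refine ⟨fun h => ⟨fun n hn => ?_, h.2.2⟩, fun h => ⟨⟨fun n hn => ?_, fun n hn => ?_⟩,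
      fun n hn => ?_, h.2⟩⟩
    · exact (Finset.mem_union.1 hn).elim (h.1.1 n) (h.1.2 n)
    · exact h.1 n (Finset.mem_union_left _ hn)
    · exact h.1 n (Finset.mem_union_right _ hn)
    · exact h.1 n (Finset.mem_union_left _ (Finset.mem_inter.1 hn).1)
  have e2 : ∀ C, A ∩ B ⊆ C → σ.responses q C ⊓
      (σ.responses q (A ∩ B) ⊓ firstMessages K L X m) =
      σ.responses q C ⊓ firstMessages K L X m := by
    intro C hC
    ext a b
    exact ⟨fun h => ⟨h.1, h.2.2⟩, fun h => ⟨h.1, fun n hn => h.1 n (hC hn), h.2⟩⟩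
  rw [e1, e2 A Finset.inter_subset_left, e2 B Finset.inter_subset_right] at h
  unfold condEntropy
  linarith

lemma condEntropy_univ_le_sum {x : Finset (Fin N) → ℝ} (hx : IsFractionalCover P x) (m : ℕ)
    (q : ∀ n, Q n) :
    σ.condEntropy m Finset.univ q ≤ ∑ T ∈ P, x T * σ.condEntropy m T q :=
  hx.le_sum_mul _ (σ.condEntropy_empty m q) (σ.condEntropy_mono m q)
    (σ.condEntropy_submodular m q)

lemma condEntropy_le [Fintype Y] (m : ℕ) (B : Finset (Fin N)) (q : ∀ n, Q n) :
    σ.condEntropy m B q ≤ (∑ n ∈ B, σ.len n (q n) : ℕ) * Real.log (Fintype.card Y) := by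
  classical
  have h1 : σ.condEntropy m B q ≤ (σ.responses q B).entropy := by
    have h := Setoid.entropy_submodular (σ.responses q B) (firstMessages K L X m) ⊤
    rw [inf_top_eq, inf_top_eq, inf_top_eq, Setoid.entropy_top] at h
    unfold condEntropy
    linarith
  have h2 : σ.responses q B =
      Setoid.ker (fun W (n : B) => σ.response n (q n) W) := by
    ext a b
    rw [Setoid.ker_def, funext_iff]
    exact ⟨fun h n => h n n.2, fun h n hn => h ⟨n, hn⟩⟩
  refine h1.trans ?_
  rw [h2]
  refine (Setoid.entropy_ker_le _).trans (le_of_eq ?_)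
  rw [Fintype.card_pi, ← Real.log_pow]
  congr 1
  norm_cast
  simp only [Fintype.card_fun, Fintype.card_fin]
  rw [Finset.prod_pow_eq_pow_sum, Finset.sum_coe_sort B fun n => σ.len n (q n)]

lemma condEntropy_eq_zero (m : ℕ) (B : Finset (Fin N)) (q : ∀ n, Q n)
    (h : ∀ n ∈ B, σ.len n (q n) = 0) : σ.condEntropy m B q = 0 := by
  have h : σ.responses q B = ⊤ := by
    ext a b
    refine ⟨fun _ => trivial, fun _ n hn => ?_⟩
    have := h n hn
    funext i
    exact (Fin.cast this i).elim0
  simp [condEntropy, h]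

/-- The bound is uniform in the queries, which gives integrability over the key. -/
lemma abs_condEntropy_le (m : ℕ) (B : Finset (Fin N)) (q : ∀ n, Q n) :
    ‖σ.condEntropy m B q‖ ≤ (⊥ : Setoid (Fin K → Fin L → X)).entropy := by
  rw [Real.norm_of_nonneg (σ.condEntropy_nonneg m B q)]
  exact (sub_le_self _ (Setoid.entropy_nonneg _)).trans (Setoid.entropy_anti bot_le)

lemma condEntropy_congr (m : ℕ) (B : Finset (Fin N)) {q q' : ∀ n, Q n}
    (h : ∀ n ∈ B, q n = q' n) : σ.condEntropy m B q = σ.condEntropy m B q' := by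
  have h : σ.responses q B = σ.responses q' B := by
    ext a b
    refine forall₂_congr fun n hn => ?_
    rw [h n hn]
  simp [condEntropy, h]

/-- Fixing one more message divides every class size by |X|^L. -/
lemma entropy_firstMessages_succ [Nonempty X] {m : ℕ} (hm : m < K) :
    (firstMessages K L X (m + 1)).entropy =
      (firstMessages K L X m).entropy + L * Real.log (Fintype.card X) := by
  classical
  have hX : (0 : ℝ) < Fintype.card X := by exact_mod_cast Fintype.card_pos
  have hc : ∀ W, (firstMessages K L X m).classCard W =
      (firstMessages K L X (m + 1)).classCard W * Fintype.card X ^ L := by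
    intro W
    have e : ∀ m, (firstMessages K L X m).classCard W =
        ∏ j : Fin K, if (j : ℕ) < m then 1 else Fintype.card X ^ L := by
      intro m
      have : (Finset.univ.filter fun b => firstMessages K L X m W b) =
          Fintype.piFinset fun j : Fin K => if (j : ℕ) < m then {W j} else Finset.univ := by
        ext b
        rw [Fintype.mem_piFinset, Finset.mem_filter]
        refine ⟨fun h j => ?_, fun h => ⟨Finset.mem_univ _, fun j hj => ?_⟩⟩
        · split_ifs with hj
          · exact Finset.mem_singleton.2 (h.2 j hj).symm
          · exact Finset.mem_univ _
        · have := h j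
          rw [if_pos hj] at this
          exact (Finset.mem_singleton.1 this).symm
      unfold Setoid.classCard
      rw [this, Fintype.card_piFinset]
      refine Finset.prod_congr rfl fun j _ => ?_
      split_ifs <;> simp
    rw [e, e, ← Finset.mul_prod_erase _ _ (Finset.mem_univ (⟨m, hm⟩ : Fin K)),
      ← Finset.mul_prod_erase _ (fun j : Fin K => if (j : ℕ) < m + 1 then _ else _)
        (Finset.mem_univ (⟨m, hm⟩ : Fin K))]
    simp only [lt_irrefl, if_false, Nat.lt_succ_self, if_true, one_mul]
    rw [mul_comm]
    congr 1
    refine Finset.prod_congr rfl fun j hj => ?_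
    have hj : (j : ℕ) ≠ m := fun h => (Finset.mem_erase.1 hj).1 (Fin.ext h)
    have : (j : ℕ) < m ↔ (j : ℕ) < m + 1 := by omega
    simp only [this]
  have hM : (0 : ℝ) < Fintype.card (Fin K → Fin L → X) := by exact_mod_cast Fintype.card_pos
  unfold Setoid.entropy
  rw [div_add' _ _ _ hM.ne']
  congr 1
  have : (L * Real.log (Fintype.card X)) * Fintype.card (Fin K → Fin L → X) =
      ∑ _W : Fin K → Fin L → X, L * Real.log (Fintype.card X) := by
    rw [Finset.sum_const, nsmul_eq_mul, Finset.card_univ, mul_comm]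
  rw [this, ← Finset.sum_add_distrib]
  refine Finset.sum_congr rfl fun W _ => ?_
  have h1 : (0 : ℝ) < (firstMessages K L X (m + 1)).classCard W := by
    exact_mod_cast Setoid.classCard_pos _ W
  rw [hc W]
  push_cast
  rw [Real.log_div hM.ne' h1.ne', Real.log_div hM.ne' (by positivity),
    Real.log_mul h1.ne' (by positivity), Real.log_pow]
  ring

/-- The responses determine the desired message. -/
lemma condEntropy_desired [Nonempty X] (k : Fin K) (q : ∀ n, Q n)
    (hq : 0 < σ.keyLaw {f | ∀ n, σ.query n k f = q n}) :
    σ.condEntropy k Finset.univ q =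
      L * Real.log (Fintype.card X) + σ.condEntropy (k + 1) Finset.univ q := by
  obtain ⟨decode, hdec⟩ := σ.correct k q hq
  have h : σ.responses q Finset.univ ⊓ firstMessages K L X k =
      σ.responses q Finset.univ ⊓ firstMessages K L X (k + 1) := by
    ext a b
    refine ⟨fun h => ⟨h.1, fun j hj => ?_⟩, fun h => ⟨h.1, fun j hj => h.2 j (by omega)⟩⟩
    rcases (Nat.lt_succ_iff_lt_or_eq.1 hj) with hj | hj
    · exact h.2 j hj
    · obtain rfl : j = k := Fin.ext hj
      rw [← hdec a, ← hdec b]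
      congr 1
      funext n
      exact h.1 n (Finset.mem_univ n)
  unfold condEntropy
  rw [h, entropy_firstMessages_succ k.2]
  ring

end Entropy

/-! ### Averaging over the queries -/

section Average

variable (σ : PIRScheme P K L X Y Ω Q)

lemma measurable_comp_query {β : Type*} [MeasurableSpace β] (k : Fin K) (g : (∀ n, Q n) → β) :
    Measurable fun f => g fun n => σ.query n k f := by
  have := σ.countable_query
  let _ : MeasurableSpace (∀ n, Q n) := ⊤
  have hq : Measurable fun f n => σ.query n k f := by
    refine measurable_to_countable' fun q => ?_
    have : (fun f n => σ.query n k f) ⁻¹' {q} = ⋂ n, {f | σ.query n k f = q n} := by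
      ext f
      simp [funext_iff]
    rw [this]
    exact MeasurableSet.iInter fun n => σ.measurableSet_query n k (q n)
  exact (measurable_from_top (f := g)).comp hq

/-- Privacy, for functions of the queries to a colluding set. -/
lemma integral_query_eq {T : Finset (Fin N)} (hT : T ∈ P) (g : (∀ n, Q n) → ℝ)
    (hg : ∀ q q' : ∀ n, Q n, (∀ n ∈ T, q n = q' n) → g q = g q') (k k' : Fin K) :
    ∫ f, g (fun n => σ.query n k f) ∂σ.keyLaw = ∫ f, g (fun n => σ.query n k' f) ∂σ.keyLaw := by
  classical
  have := σ.countable_query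
  have := σ.isProbabilityMeasure_keyLaw
  obtain ⟨f₀⟩ : Nonempty Ω := nonempty_of_isProbabilityMeasure σ.keyLaw
  let _ : MeasurableSpace (∀ n, Q n) := ⊤
  let q₀ : ∀ n, Q n := fun n => σ.query n k f₀
  -- Freezing the queries outside `T` gives a law on a countable space whose atoms are either empty
  -- or exactly the events in `privacy`.
  let ρ : (∀ n, Q n) → ∀ n, Q n := fun q n => if n ∈ T then q n else q₀ n
  have hm : ∀ k, Measurable fun f => ρ fun n => σ.query n k f :=
    fun k => σ.measurable_comp_query k ρ
  have hlaw : σ.keyLaw.map (fun f => ρ fun n => σ.query n k f) =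
      σ.keyLaw.map (fun f => ρ fun n => σ.query n k' f) := by
    refine Measure.ext_of_singleton fun q => ?_
    rw [Measure.map_apply (hm k) (measurableSet_singleton q),
      Measure.map_apply (hm k') (measurableSet_singleton q)]
    by_cases hq : ∀ n ∉ T, q n = q₀ n
    · have e : ∀ k, (fun f => ρ fun n => σ.query n k f) ⁻¹' {q} =
          {f | ∀ n ∈ T, σ.query n k f = q n} := by
        intro k
        ext f
        simp only [Set.mem_preimage, Set.mem_singleton_iff, funext_iff, Set.mem_ofPred_eq, ρ]
        refine forall_congr' fun n => ?_
        by_cases hn : n ∈ T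
        · simp [hn]
        · simp [hn, hq n hn]
      rw [e, e]
      exact σ.privacy T hT k k' q
    · have e : ∀ k, (fun f => ρ fun n => σ.query n k f) ⁻¹' {q} = ∅ := by
        intro k
        rw [Set.eq_empty_iff_forall_notMem]
        rintro f rfl
        exact hq fun n hn => by simp [ρ, hn]
      rw [e, e]
  have e : ∀ k, ∫ f, g (fun n => σ.query n k f) ∂σ.keyLaw =
      ∫ q, g q ∂(σ.keyLaw.map fun f => ρ fun n => σ.query n k f) := by
    intro k
    rw [integral_map (hm k).aemeasurable (measurable_from_top (f := g)).aestronglyMeasurable]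
    refine integral_congr_ae (Filter.Eventually.of_forall fun f => hg _ _ fun n hn => ?_)
    simp [ρ, hn]
  rw [e, e, hlaw]

/-- Almost surely the realized queries have positive probability. -/
lemma ae_query_pos (k : Fin K) :
    ∀ᵐ f ∂σ.keyLaw, 0 < σ.keyLaw {f' | ∀ n, σ.query n k f' = σ.query n k f} := by
  have := σ.countable_query
  have h : ∀ᵐ f ∂σ.keyLaw, ∀ q : ∀ n, Q n, σ.keyLaw {f' | ∀ n, σ.query n k f' = q n} = 0 →
      ¬ ∀ n, σ.query n k f = q n := by
    refine ae_all_iff.2 fun q => ?_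
    by_cases hq : σ.keyLaw {f' | ∀ n, σ.query n k f' = q n} = 0
    · filter_upwards [measure_eq_zero_iff_ae_notMem.1 hq] with f hf _
      exact hf
    · exact Filter.Eventually.of_forall fun f h => absurd h hq
  filter_upwards [h] with f hf
  rw [pos_iff_ne_zero]
  exact fun h0 => hf _ h0 fun n => rfl

variable [Fintype X]

lemma integrable_condEntropy (k : Fin K) (m : ℕ) (B : Finset (Fin N)) :
    Integrable (fun f => σ.condEntropy m B fun n => σ.query n k f) σ.keyLaw := by
  have := σ.isProbabilityMeasure_keyLaw
  exact Integrable.of_bound (σ.measurable_comp_query k _).aestronglyMeasurable _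
    (Filter.Eventually.of_forall fun f => σ.abs_condEntropy_le m B _)

/-- The conditional entropy of the responses, averaged over the queries for message `k`. -/
noncomputable def meanEntropy (k : Fin K) (m : ℕ) (B : Finset (Fin N)) : ℝ :=
  ∫ f, σ.condEntropy m B (fun n => σ.query n k f) ∂σ.keyLaw

lemma meanEntropy_nonneg (k : Fin K) (m : ℕ) (B : Finset (Fin N)) :
    0 ≤ σ.meanEntropy k m B :=
  integral_nonneg fun _ => σ.condEntropy_nonneg m B _

lemma meanEntropy_privacy {T : Finset (Fin N)} (hT : T ∈ P) (k k' : Fin K) (m : ℕ) :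
    σ.meanEntropy k m T = σ.meanEntropy k' m T :=
  σ.integral_query_eq hT _ (fun _ _ h => σ.condEntropy_congr m T h) k k'

lemma meanEntropy_mono (k : Fin K) (m : ℕ) : Monotone (σ.meanEntropy k m) :=
  fun B B' h => integral_mono (σ.integrable_condEntropy k m B) (σ.integrable_condEntropy k m B')
    fun _ => σ.condEntropy_mono m _ h

lemma meanEntropy_desired [Nonempty X] (k : Fin K) :
    σ.meanEntropy k k Finset.univ =
      L * Real.log (Fintype.card X) + σ.meanEntropy k (k + 1) Finset.univ := by
  have := σ.isProbabilityMeasure_keyLaw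
  unfold meanEntropy
  rw [integral_congr_ae (g := fun f => L * Real.log (Fintype.card X) +
    σ.condEntropy (k + 1) Finset.univ fun n => σ.query n k f)]
  · rw [integral_add (integrable_const _) (σ.integrable_condEntropy k _ _)]
    simp
  · filter_upwards [σ.ae_query_pos k] with f hf
    exact σ.condEntropy_desired k _ hf

/-- The desired message changes from `k'` to `k`. Privacy controls only colluding sets, so Shearer's
inequality has to come first. -/
lemma meanEntropy_univ_le_sum {x : Finset (Fin N) → ℝ} (hx : IsFractionalCover P x) (k k' : Fin K)
    (m : ℕ) : σ.meanEntropy k' m Finset.univ ≤ ∑ T ∈ P, x T * σ.meanEntropy k m T := by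
  calc σ.meanEntropy k' m Finset.univ
      ≤ ∫ f, ∑ T ∈ P, x T * σ.condEntropy m T (fun n => σ.query n k' f) ∂σ.keyLaw :=
        integral_mono (σ.integrable_condEntropy k' m _)
          (integrable_finsetSum _ fun T _ => (σ.integrable_condEntropy k' m T).const_mul _)
          fun f => σ.condEntropy_univ_le_sum hx m _
    _ = ∑ T ∈ P, x T * σ.meanEntropy k' m T := by
        rw [integral_finsetSum _ fun T _ => (σ.integrable_condEntropy k' m T).const_mul _]
        exact Finset.sum_congr rfl fun T _ => integral_const_mul _ _
    _ = _ := Finset.sum_congr rfl fun T hT => by rw [σ.meanEntropy_privacy hT k' k]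

lemma sum_mul_meanEntropy_le {x : Finset (Fin N) → ℝ} (hx : IsFractionalCover P x) (k : Fin K)
    (m : ℕ) : ∑ T ∈ P, x T * σ.meanEntropy k m T ≤
      (∑ T ∈ P, x T) * σ.meanEntropy k m Finset.univ := by
  rw [Finset.sum_mul]
  exact Finset.sum_le_sum fun T hT => mul_le_mul_of_nonneg_left
    (σ.meanEntropy_mono k m (Finset.subset_univ T)) (hx.1 T hT)

/-- The converse bound. -/
lemma le_meanEntropy [Nonempty X] {x : Finset (Fin N) → ℝ} (hx : IsFractionalCover P x)
    (hpos : 0 < ∑ T ∈ P, x T) (d m : ℕ) (hm : m < K) (hd : m + d + 1 = K) :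
    L * Real.log (Fintype.card X) * ∑ j ∈ Finset.range (d + 1), (1 / ∑ T ∈ P, x T) ^ j ≤
      σ.meanEntropy ⟨m, hm⟩ m Finset.univ := by
  have h0 := σ.meanEntropy_desired ⟨m, hm⟩
  simp only at h0
  -- Here `d` counts the messages after `m`. Each step passes to desired message `m + 1` at the cost
  -- of a factor 1/ξ.
  induction d generalizing m with
  | zero =>
    have := σ.meanEntropy_nonneg ⟨m, hm⟩ (m + 1) Finset.univ
    simp only [zero_add, Finset.sum_range_one, pow_zero, mul_one]
    linarith
  | succ d ih =>
    have hm' : m + 1 < K := by omega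
    have h1 := ih (m + 1) hm' (by omega) (σ.meanEntropy_desired ⟨m + 1, hm'⟩)
    have h2 := σ.meanEntropy_univ_le_sum hx ⟨m, hm⟩ ⟨m + 1, hm'⟩ (m + 1)
    have h3 := σ.sum_mul_meanEntropy_le hx ⟨m, hm⟩ (m + 1)
    rw [h0, Finset.sum_range_succ', pow_zero, mul_add, mul_one, add_comm]
    refine add_le_add_right ?_ _
    simp only [pow_succ]
    rw [← Finset.sum_mul, ← mul_assoc, mul_one_div, div_le_iff₀ hpos, mul_comm (σ.meanEntropy _ _ _)]
    exact h1.trans (h2.trans h3)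

end Average

end PIRScheme

/-! ### Equality in the converse bound -/

namespace PIRScheme

variable {N : ℕ} {P : Finset (Finset (Fin N))} {K L : ℕ} {X Y : Type*}
  {Ω : Type*} [MeasurableSpace Ω] {Q : Fin N → Type*}

/-- For a capacity-achieving scheme some tuple of queries has responses that are uniform and whose
interference is nontrivial and determined by the responses of every colluding set. -/
lemma exists_tight_query [Fintype X] [Nonempty X] [Fintype Y] (σ : PIRScheme P K L X Y Ω Q)
    (hK : 2 ≤ K) {x : Finset (Fin N) → ℝ} (hx : IsFractionalCover P x) (hx0 : ∀ T ∈ P, 0 < x T)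
    (hP : P.Nonempty) (hΛ : 0 < L * Real.log (Fintype.card X))
    (hint : Integrable (fun f => ((∑ n, σ.len n (σ.query n ⟨0, by omega⟩ f) : ℕ) : ℝ)) σ.keyLaw)
    (hD : σ.expectedDownload ⟨0, by omega⟩ * Real.log (Fintype.card Y) ≤
      L * Real.log (Fintype.card X) * ∑ j ∈ Finset.range K, (1 / ∑ T ∈ P, x T) ^ j) :
    ∃ q : ∀ n, Q n,
      L * Real.log (Fintype.card X) + σ.condEntropy 1 Finset.univ q =
        (∑ n, σ.len n (q n) : ℕ) * Real.log (Fintype.card Y) ∧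
      (∀ T ∈ P, σ.condEntropy 1 T q = σ.condEntropy 1 Finset.univ q) ∧
      0 < σ.condEntropy 1 Finset.univ q := by
  have := σ.isProbabilityMeasure_keyLaw
  set Λ := L * Real.log (Fintype.card X)
  set ξ := ∑ T ∈ P, x T
  have hξ : 0 < ξ := Finset.sum_pos hx0 hP
  obtain ⟨d, rfl⟩ : ∃ d, K = d + 1 + 1 := ⟨K - 2, by omega⟩
  let k : Fin (d + 1 + 1) := ⟨0, by omega⟩
  have hle : ∀ f, σ.condEntropy 0 Finset.univ (fun n => σ.query n k f) ≤
      ((∑ n, σ.len n (σ.query n k f) : ℕ) : ℝ) * Real.log (Fintype.card Y) :=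
    fun f => σ.condEntropy_le 0 Finset.univ _
  have h1 : σ.meanEntropy k 0 Finset.univ ≤
      σ.expectedDownload k * Real.log (Fintype.card Y) := by
    unfold meanEntropy expectedDownload
    rw [← integral_mul_const]
    exact integral_mono (σ.integrable_condEntropy k 0 _) (hint.mul_const _) hle
  have h2 := σ.le_meanEntropy hx hξ (d + 1) 0 (by omega) (by omega)
  have h3 : σ.meanEntropy k 0 Finset.univ = Λ + σ.meanEntropy k 1 Finset.univ :=
    σ.meanEntropy_desired k
  have h4 : Λ * ∑ j ∈ Finset.range (d + 1), (1 / ξ) ^ j ≤ ∑ T ∈ P, x T * σ.meanEntropy k 1 T :=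
    (σ.le_meanEntropy hx hξ d 1 (by omega) (by omega)).trans
      (σ.meanEntropy_univ_le_sum hx k _ 1)
  have h5 := σ.sum_mul_meanEntropy_le hx k 1
  -- The download bound reverses the chain `h4`, `h5`, so both become equalities.
  have h6 : ξ * σ.meanEntropy k 1 Finset.univ ≤
      Λ * ∑ j ∈ Finset.range (d + 1), (1 / ξ) ^ j := by
    have h : Λ + σ.meanEntropy k 1 Finset.univ ≤
        Λ * ∑ j ∈ Finset.range (d + 1 + 1), (1 / ξ) ^ j := h3 ▸ h1.trans hD
    rw [Finset.sum_range_succ'] at h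
    simp only [pow_zero, pow_succ] at h
    rw [← Finset.sum_mul] at h
    have h' : σ.meanEntropy k 1 Finset.univ ≤
        (Λ * ∑ j ∈ Finset.range (d + 1), (1 / ξ) ^ j) / ξ := by
      rw [div_eq_mul_one_div]
      linarith
    rwa [le_div_iff₀ hξ, mul_comm] at h'
  have hmean : ∀ T ∈ P, σ.meanEntropy k 1 T = σ.meanEntropy k 1 Finset.univ := by
    have hsum : ∑ T ∈ P, x T * σ.meanEntropy k 1 T =
        ∑ T ∈ P, x T * σ.meanEntropy k 1 Finset.univ := by
      rw [← Finset.sum_mul]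
      exact le_antisymm h5 (h6.trans h4)
    intro T hT
    exact mul_left_cancel₀ (hx0 T hT).ne' ((Finset.sum_eq_sum_iff_of_le fun T hT =>
      mul_le_mul_of_nonneg_left (σ.meanEntropy_mono k 1 (Finset.subset_univ T))
        (hx.1 T hT)).1 hsum T hT)
  -- `K ≥ 2` leaves at least the term j = 0 in the geometric sum of `h4`.
  have hpos : 0 < σ.meanEntropy k 1 Finset.univ := by
    refine pos_of_mul_pos_right (lt_of_lt_of_le ?_ (h4.trans h5)) hξ.le
    exact mul_pos hΛ (Finset.sum_pos (fun j _ => by positivity) ⟨0, by simp⟩)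
  have hae1 : ∀ᵐ f ∂σ.keyLaw, σ.condEntropy 0 Finset.univ (fun n => σ.query n k f) =
      ((∑ n, σ.len n (σ.query n k f) : ℕ) : ℝ) * Real.log (Fintype.card Y) := by
    refine (integral_eq_iff_of_ae_le (σ.integrable_condEntropy k 0 _) (hint.mul_const _)
      (Filter.Eventually.of_forall hle)).1 ?_
    rw [integral_mul_const]
    exact le_antisymm h1 (hD.trans h2)
  have hae2 : ∀ᵐ f ∂σ.keyLaw, ∀ T ∈ P, σ.condEntropy 1 T (fun n => σ.query n k f) =
      σ.condEntropy 1 Finset.univ (fun n => σ.query n k f) :=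
    (Finset.eventually_all P).2 fun T hT => (integral_eq_iff_of_ae_le
      (σ.integrable_condEntropy k 1 T) (σ.integrable_condEntropy k 1 _)
      (Filter.Eventually.of_forall fun f => σ.condEntropy_mono 1 _ (Finset.subset_univ T))).1
      (hmean T hT)
  -- Almost every key satisfies both equalities. If none of these had positive interference entropy,
  -- the mean would be nonpositive.
  by_contra hcon
  refine hpos.not_ge (integral_nonpos_of_ae ?_)
  filter_upwards [hae1, hae2, σ.ae_query_pos k] with f hf1 hf2 hf3
  by_contra hf
  exact hcon ⟨fun n => σ.query n k f, (σ.condEntropy_desired k _ hf3).symm.trans hf1, hf2,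
    not_le.1 hf⟩

/-- The surviving set `T` already carries all the interference entropy, so the symbols downloaded
outside `T` amount to at most L log|X|. -/
lemma hittingNumber_mul_log_le [Fintype X] [Nonempty X] [Fintype Y]
    (σ : PIRScheme P K L X Y Ω Q) (hP : P.Nonempty) (hY : 0 ≤ Real.log (Fintype.card Y))
    (q : ∀ n, Q n)
    (hunif : L * Real.log (Fintype.card X) + σ.condEntropy 1 Finset.univ q =
      (∑ n, σ.len n (q n) : ℕ) * Real.log (Fintype.card Y))
    (hT : ∀ T ∈ P, σ.condEntropy 1 T q = σ.condEntropy 1 Finset.univ q)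
    (hpos : 0 < σ.condEntropy 1 Finset.univ q) :
    hittingNumber (residualFamily P) * Real.log (Fintype.card Y) ≤
      L * Real.log (Fintype.card X) := by
  obtain ⟨T, hTP, hle⟩ := exists_subset_hittingNumber_le hP (fun n => σ.len n (q n))
    fun T hTP => by
      by_contra! h
      refine hpos.ne' ((hT T hTP).symm.trans (σ.condEntropy_eq_zero 1 T q fun n hn => ?_))
      exact Nat.lt_one_iff.1 (h n hn)
  have h1 := σ.condEntropy_le 1 T q
  have h2 := mul_le_mul_of_nonneg_right (Nat.cast_le (α := ℝ).2 hle) hY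
  rw [Nat.cast_add, add_mul] at h2
  rw [hT T hTP] at h1
  linarith

end PIRScheme

/-! ### From capacity to equality in the converse -/

theorem theorem2 {N : ℕ} (P : Finset (Finset (Fin N))) (K L : ℕ) (hK : 2 ≤ K) (hL : 0 < L)
    -- some optimal fractional cover is positive on all of `P`; in particular `P` covers all servers
    (hP : ∃ x : Finset (Fin N) → ℝ, IsOptimalFractionalCover P x ∧ ∀ T ∈ P, 0 < x T)
    {X Y : Type*} [Fintype X] [Nonempty X] [Fintype Y] [AddCommGroup Y]
    {Ω : Type*} [MeasurableSpace Ω] {Q : Fin N → Type*}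
    (σ : PIRScheme P K L X Y Ω Q)
    (hσ : σ.IsUniformlyDecomposable) (hcap : σ.AchievesCapacity) :
    (hittingNumber (residualFamily P) : ℝ) * Real.logb 2 (Fintype.card Y)
        ≤ L * Real.logb 2 (Fintype.card X) ∧
      (hittingNumber (residualFamily P) : ℝ)
        ≤ (hittingNumber (residualFamily P) : ℝ) * Real.logb 2 (Fintype.card Y) := by
  obtain ⟨x, hx, hx0⟩ := hP
  have hlog2 : 0 < Real.log 2 := Real.log_pos one_lt_two
  let k : Fin K := ⟨0, by omega⟩
  have hS0 : 0 ≤ packingValue P :=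
    (Finset.sum_nonneg hx.1.1).trans hx.sum_le_packingValue
  have hsum : 0 < ∑ j ∈ Finset.range K, (1 / packingValue P) ^ j :=
    Finset.sum_pos' (fun j _ => by positivity) ⟨0, by simpa using by omega, by simp⟩
  have hrate : σ.rate k = (∑ j ∈ Finset.range K, (1 / packingValue P) ^ j)⁻¹ := hcap k
  have hne : σ.rate k ≠ 0 := by
    rw [hrate]
    exact (inv_pos.2 hsum).ne'
  unfold PIRScheme.rate at hrate hne
  -- The capacity is nonzero, and division by zero gives zero, so no factor of the rate vanishes.
  -- This rules out one-letter alphabets.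
  obtain ⟨hX, hYD⟩ := div_ne_zero_iff.1 hne
  have hX := (mul_ne_zero_iff.1 hX).2
  obtain ⟨hY, hD⟩ := mul_ne_zero_iff.1 hYD
  have hlogX : 0 < Real.log (Fintype.card X) :=
    lt_of_le_of_ne (Real.log_natCast_nonneg _) fun h => hX (by simp [Real.logb, ← h])
  have hlogY : 0 < Real.log (Fintype.card Y) :=
    lt_of_le_of_ne (Real.log_natCast_nonneg _) fun h => hY (by simp [Real.logb, ← h])
  have hΛ : 0 < L * Real.log (Fintype.card X) := mul_pos (Nat.cast_pos.2 hL) hlogX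
  -- The integral of a non-integrable function is zero by convention, so a nonzero expected download
  -- is finite.
  have hint : Integrable (fun f => ((∑ n, σ.len n (σ.query n k f) : ℕ) : ℝ)) σ.keyLaw :=
    not_imp_comm.1 integral_undef hD
  have hPne : P.Nonempty := by
    rw [Finset.nonempty_iff_ne_empty]
    rintro rfl
    refine hD ?_
    have : IsEmpty (Fin N) := ⟨fun n => absurd (hx.1.2 n) (by simp)⟩
    simp [PIRScheme.expectedDownload]
  have hξ : 0 < ∑ T ∈ P, x T := Finset.sum_pos hx0 hPne
  have hdown : σ.expectedDownload k * Real.log (Fintype.card Y) ≤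
      L * Real.log (Fintype.card X) * ∑ j ∈ Finset.range K, (1 / ∑ T ∈ P, x T) ^ j := by
    have h : σ.expectedDownload k * Real.log (Fintype.card Y) =
        L * Real.log (Fintype.card X) * ∑ j ∈ Finset.range K, (1 / packingValue P) ^ j := by
      rw [div_eq_iff hYD, inv_mul_eq_div, eq_div_iff hsum.ne'] at hrate
      unfold Real.logb at hrate
      field_simp at hrate ⊢
      linarith
    rw [h]
    -- ξ ≤ S* is the only direction of duality needed, since it makes the powers of 1/ξ the larger
    -- ones.
    have := hx.sum_le_packingValue
    gcongr
  obtain ⟨q, h1, h2, h3⟩ := σ.exists_tight_query hK hx.1 hx0 hPne hΛ hint hdown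
  have hmain := σ.hittingNumber_mul_log_le hPne hlogY.le q h1 h2 h3
  constructor
  · unfold Real.logb
    rw [← mul_div_assoc, ← mul_div_assoc]
    exact div_le_div_of_nonneg_right hmain hlog2.le
  · refine le_mul_of_one_le_right (Nat.cast_nonneg _) ?_
    have h : 1 < Fintype.card Y := by
      by_contra! h
      exact hlogY.not_ge (Real.log_nonpos (Nat.cast_nonneg _) (by exact_mod_cast h))
    rw [Real.le_logb_iff_rpow_le one_lt_two (by positivity), Real.rpow_one]
    exact_mod_cast h
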